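/- \textbf{Setting.} Let $X$ be a finite state space and $\mathcal A$ a nonempty finite set of actions, each a map $\alpha:X\to X$ (a deterministic action). Put an edge from $x$ to $y$ if $\alpha(x)=y$ for some $\alpha\in\mathcal A$. Assume that the actions are \emph{reversible} (there is an edge from $x$ to $y$ iff there is one from $y$ to $x$) and that the resulting graph on $X$ is connected. Let $P(x,y)=|\{\alpha\in\mathcal A:\alpha(x)=y\}|/|\mathcal A|$. Let $\Sigma$ be a finite set of sensors with a fixed-point free involution $a\mapsto a^\ast$. A sensor $a$ of order $n_a\ge 0$ is realized by a set $\rho(a)\subseteq X^{n_a+1}$, where $n_{a^\ast}=n_a$ and $\rho(a^\ast)=X^{n_a+1}\setminus\rho(a)$; along a trajectory $\varphi:\mathbb Z\to X$ it is on at time $t$ iff $(\varphi_{t-n_a},\dots,\varphi_t)\in\rho(a)$. A pair $a,b$ is \emph{proper} if $b\ne a,a^\ast$. Proper pairs carry learning thresholds $\tau_{ab}=\tau_{ba}=\tau_{a^\ast b}=\tau_{ab^\ast}\in[0,\tfrac14]$. The agent starts at time $0$ with a trivial snapshot (all weights are $0$), so that its empirical snapshot at time $t$ has the weights $w^t_{ab}=|\{1\le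 k\le t: a\text{ and }b\text{ are on at time }k\}|$. The derived poc graph has a directed edge from $a$ to $b$ (write $\mathrm{Dir}^t_{ab}=1$, and $0$ otherwise) iff $a,b$ is proper and $w^t_{ab^\ast}<\min\{\tau_{ab}\,t,\ w^t_{ab},\ w^t_{a^\ast b},\ w^t_{a^\ast b^\ast}\}$. For a stationary distribution $\pi$ of $P$ let $\pi(ab)$ be the probability that $a$ and $b$ are on simultaneously along the stationary chain; for sensors of order $0$ this is $\pi(\rho(a)\cap\rho(b))$. For a proper pair put $m_{ab}=\min\{\tau_{ab},\pi(ab),\pi(a^\ast b^\ast),\pi(a^\ast b)\}$, and let $\mathrm{Dir}^\infty_{ab}=1$ iff $a,b$ is proper and $\pi(ab^\ast)<m_{ab}$, and $0$ otherwise. Let $Err(t)=\sum_{a,b\in\Sigma}|\mathrm{Dir}^t_{ab}-\mathrm{Dir}^\infty_{ab}|$. The agent performs a random walk: $\varphi_{t+1}=\alpha_t(\varphi_t)$ almost surely with $\alpha_t\in\mathcal A$ for every $t\in\mathbb Z$, where for $t\ge 0$ the action $\alpha_t$ is uniform on $\mathcal A$ and independent of $(\varphi_s)_{s\le t}$. The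 law of $(\varphi_s)_{s\le 0}$ is otherwise arbitrary. \textbf{Proposition.} The chain $P$ has exactly one stationary distribution $\pi$. Assume that no proper pair is tied at a positive level, i.e. $\pi(ab^\ast)=m_{ab}$ only if both sides are $0$. Then $Err(t)$ converges to zero at an exponential rate: there are constants $C$ and $c>0$, which depend only on $X$, the actions, the sensors and the thresholds, such that for every random walk of the agent $$\mathbb E[Err(t)]\le C e^{-ct}\quad\text{for all integers } t\ge 0,$$ and $Err(t)\to 0$ almost surely. -/

import Mathlib

namespace BinaryAgent

/-! ### Sensors -/

/-- The last `n + 1` entries of a sequence of `N + 1` states, where `n ≤ N`. -/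
def lastEntries {X : Type*} {n N : ℕ} (h : n ≤ N) (x : Fin (N + 1) → X) : Fin (n + 1) → X :=
  fun i => x ⟨N - n + i, by omega⟩

/-- A binary sensorium over the state space `X`, indexed by a set `S` with an involution
`a ↦ star a`. A sensor `a` of order `n` is realized by a set of `n`-transitions, that is, of
`(n + 1)`-tuples of states; `star a` is the negation of `a`. Sensors of order `0` are the state
sensors. -/
structure Sensorium (X S : Type*) [InvolutiveStar S] where
  /-- The involution has no fixed points. -/
  star_ne : ∀ a : S, star a ≠ a
  /-- The order of a sensor. -/
  order : S → ℕ
  order_star : ∀ a, order (star a) = order a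
  /-- The realization of a sensor. -/
  realization : (a : S) → Set (Fin (order a + 1) → X)
  /-- `star a` is realized by the complement of the realization of `a`. -/
  realization_star : ∀ (a : S) (x : Fin (order a + 1) → X),
    (fun i => x (Fin.cast (congrArg (· + 1) (order_star a)) i)) ∈ realization (star a) ↔
      x ∉ realization a

/-- The `n`-transition `(φ (t - n), …, φ t)` made by the trajectory `φ` at time `t`. -/
def transition {X : Type*} (φ : ℤ → X) (n : ℕ) (t : ℤ) : Fin (n + 1) → X :=
  fun i => φ (t - n + (i : ℕ))

/-- The raw observation at time `t` along the trajectory `φ`: the set of sensors that are on. -/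
def Sensorium.observe {X S : Type*} [InvolutiveStar S] (R : Sensorium X S) (φ : ℤ → X) (t : ℤ) :
    Set S :=
  {a | transition φ (R.order a) t ∈ R.realization a}

/-! ### Snapshots -/

section Snapshots

variable {S : Type*} [InvolutiveStar S]

/-- The proper pairs: the edges of the complete graph on `S` with all edges `{a, star a}`
removed. -/
def Proper (a b : S) : Prop := a ≠ b ∧ a ≠ star b

/-- A snapshot over `S`: a state (a `*`-selection), and weights and learning thresholds on the
proper pairs. Values at pairs that are not proper carry no meaning. -/
structure Snapshot (S : Type*) [InvolutiveStar S] where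
  /-- The state vector. -/
  state : Set S
  state_selection : ∀ a ∈ state, star a ∉ state
  /-- The edge weights. -/
  weight : S → S → ℝ
  weight_symm : ∀ a b, Proper a b → weight a b = weight b a
  weight_nonneg : ∀ a b, Proper a b → 0 ≤ weight a b
  /-- The learning thresholds. -/
  threshold : S → S → ℝ
  threshold_symm : ∀ a b, Proper a b → threshold a b = threshold b a
  threshold_star_left : ∀ a b, Proper a b → threshold (star a) b = threshold a b
  threshold_star_right : ∀ a b, Proper a b → threshold a (star b) = threshold a b
  threshold_nonneg : ∀ a b, Proper a b → 0 ≤ threshold a b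
  threshold_le : ∀ a b, Proper a b → threshold a b ≤ 1 / 4

/-- A snapshot is trivial if all its weights vanish. -/
def Snapshot.IsTrivial (T : Snapshot S) : Prop := ∀ a b, Proper a b → T.weight a b = 0

/-- The clock `w a + w (star a)`, where `w a := w a b + w a (star b)`. For empirical snapshots it
does not depend on the proper pair `a`, `b` through which it is computed. -/
def clock (w : S → S → ℝ) (a b : S) : ℝ :=
  (w a b + w a (star b)) + (w (star a) b + w (star a) (star b))

/-- There is a directed edge from `a` to `b` in the poc graph derived from the weights `w` and the
thresholds `τ`. -/
def PocEdge (w τ : S → S → ℝ) (a b : S) : Prop :=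
  Proper a b ∧
    w a (star b) < min (τ a b * clock w a b)
      (min (w a b) (min (w (star a) b) (w (star a) (star b))))

/-- The derived poc graph of an empirical snapshot. -/
def Snapshot.Dir (T : Snapshot S) (a b : S) : Prop := PocEdge T.weight T.threshold a b

/-- The upper closure of `O` in the reflexive-transitive closure of the relation `r`. -/
def upSet (r : S → S → Prop) (O : Set S) : Set S :=
  {b | ∃ a ∈ O, Relation.ReflTransGen r a b}

/-- The coherent projection of `O`: its upper closure, minus all negations of members of it. -/
def coherentProjection (r : S → S → Prop) (O : Set S) : Set S :=
  upSet r O \ {b | star b ∈ upSet r O}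

/-- The weights after the observation `O` has been recorded. -/
noncomputable def updateWeight (w : S → S → ℝ) (O : Set S) (a b : S) : ℝ :=
  w a b + O.indicator 1 a * O.indicator 1 b

/-- The empirical update of a snapshot by an observation `O`. The new state is the coherent
projection of `O` with respect to the poc set derived from the new weights. -/
noncomputable def Snapshot.update (T : Snapshot S) (O : Set S) : Snapshot S where
  state := coherentProjection (PocEdge (updateWeight T.weight O) T.threshold) O
  state_selection a ha h := ha.2 h.1
  weight := updateWeight T.weight O
  weight_symm a b h := by
    simp only [updateWeight, T.weight_symm a b h]
    ring
  weight_nonneg a b h :=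
    add_nonneg (T.weight_nonneg a b h)
      (mul_nonneg (Set.indicator_nonneg (fun _ _ => zero_le_one) _)
        (Set.indicator_nonneg (fun _ _ => zero_le_one) _))
  threshold := T.threshold
  threshold_symm := T.threshold_symm
  threshold_star_left := T.threshold_star_left
  threshold_star_right := T.threshold_star_right
  threshold_nonneg := T.threshold_nonneg
  threshold_le := T.threshold_le

/-- The snapshot held at time `t` by an empirical agent which starts with the snapshot `T₀` at
time `0` and moves along the trajectory `φ`. -/
noncomputable def snapshotAt {X : Type*} (R : Sensorium X S) (T₀ : Snapshot S) (φ : ℤ → X) :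
    ℕ → Snapshot S
  | 0 => T₀
  | t + 1 => (snapshotAt R T₀ φ t).update (R.observe φ ((t + 1 : ℕ) : ℤ))

end Snapshots

/-! ### Random walks driven by deterministic actions -/

section Walks

variable {X A : Type*}

/-- There is an edge from `x` to `y`: some action takes `x` to `y`. -/
def Step (act : A → X → X) (x y : X) : Prop := ∃ i, act i x = y

/-- The actions are reversible: there is an edge from `x` to `y` iff there is one from `y` to
`x`. -/
def Reversible (act : A → X → X) : Prop := ∀ x y, Step act x y ↔ Step act y x

/-- The transition matrix of the chain that applies a uniformly random action at every state. -/
noncomputable def transitionMatrix [Fintype A] (act : A → X → X) : Matrix X X ℝ :=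
  fun x y => (Nat.card {i : A // act i x = y} : ℝ) / Fintype.card A

/-- `π` is a stationary probability distribution of the chain. -/
def IsStationary [Fintype X] [Fintype A] (act : A → X → X) (π : X → ℝ) : Prop :=
  π ∈ stdSimplex ℝ X ∧ Matrix.vecMul π (transitionMatrix act) = π

/-- A random trajectory `φ` of an agent which, from time `0` on, chooses its action uniformly at
random and independently of its trajectory so far. Its motion before time `0` is an arbitrary
random sequence of transitions allowed by the actions; in particular its position at time `0` is
arbitrary. -/
structure IsRandomWalk [Fintype A] [MeasurableSpace X] [MeasurableSpace A] {Ω : Type*}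
    [MeasurableSpace Ω] (μ : MeasureTheory.Measure Ω) (act : A → X → X) (φ : ℤ → Ω → X)
    (α : ℤ → Ω → A) : Prop where
  measurable_state : ∀ t, Measurable (φ t)
  measurable_action : ∀ t, Measurable (α t)
  step : ∀ t, ∀ᵐ ω ∂μ, φ (t + 1) ω = act (α t ω) (φ t ω)
  uniform : ∀ t, 0 ≤ t → ∀ i, μ {ω | α t ω = i} = (Fintype.card A : ENNReal)⁻¹
  indep : ∀ t, 0 ≤ t →
    ProbabilityTheory.IndepFun (α t) (fun ω (s : Set.Iic t) => φ s ω) μ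

end Walks

/-! ### The true implication matrix and the error -/

section Error

variable {X A S : Type*} [Fintype X] [Fintype A] [InvolutiveStar S]

/-- The probability that the chain started from `π` runs through the states `x 0, …, x N`. -/
noncomputable def pathProb (act : A → X → X) (π : X → ℝ) {N : ℕ} (x : Fin (N + 1) → X) : ℝ :=
  π (x 0) * ∏ i : Fin N, transitionMatrix act (x i.castSucc) (x i.succ)

open Classical in
/-- The stationary probability that the sensors `a` and `b` fire simultaneously. For state sensors
this is the `π`-mass of the intersection of their realizations. -/
noncomputable def jointProb (act : A → X → X) (π : X → ℝ) (R : Sensorium X S) (a b : S) : ℝ :=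
  ∑ x : Fin (max (R.order a) (R.order b) + 1) → X,
    if lastEntries (le_max_left _ _) x ∈ R.realization a ∧
        lastEntries (le_max_right _ _) x ∈ R.realization b
    then pathProb act π x else 0

/-- The bound which the stationary probability of `a` and `star b` must stay below for the
implication from `a` to `b` to be counted as true. -/
noncomputable def trueBound (act : A → X → X) (π : X → ℝ) (R : Sensorium X S) (τ : S → S → ℝ)
    (a b : S) : ℝ :=
  min (τ a b) (min (jointProb act π R a b)
    (min (jointProb act π R (star a) (star b)) (jointProb act π R (star a) b)))

/-- The true thresholded implication relation. -/
def TrueDir (act : A → X → X) (π : X → ℝ) (R : Sensorium X S) (τ : S → S → ℝ) (a b : S) : Prop :=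
  Proper a b ∧ jointProb act π R a (star b) < trueBound act π R τ a b

/-- No implication is tied at a positive level: whenever the two sides of the strict inequality
defining `TrueDir` are equal, they vanish. -/
def NoPositiveTies (act : A → X → X) (π : X → ℝ) (R : Sensorium X S) (τ : S → S → ℝ) : Prop :=
  ∀ a b, Proper a b → jointProb act π R a (star b) = trueBound act π R τ a b →
    jointProb act π R a (star b) = 0

open Classical in
/-- The `0`-`1` matrix of a relation. -/
noncomputable def dirMatrix (r : S → S → Prop) (a b : S) : ℝ := if r a b then 1 else 0

/-- The error at time `t` along the trajectory `φ`: the `ℓ¹` distance between the matrix of the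
derived poc graph of the snapshot and the true thresholded implication matrix. -/
noncomputable def err [Fintype S] (act : A → X → X) (π : X → ℝ) (R : Sensorium X S)
    (T₀ : Snapshot S) (φ : ℤ → X) (t : ℕ) : ℝ :=
  ∑ a : S, ∑ b : S, |dirMatrix (snapshotAt R T₀ φ t).Dir a b -
    dirMatrix (TrueDir act π R T₀.threshold) a b|

end Error

end BinaryAgent

/-!
The theorem is a large-deviation estimate for finitely many additive functionals of the walk.

For a proper pair `a`, `b`, whether the empirical poc graph has an edge from `a` to `b` at time `t`
is decided by comparing a sum `∑ u` over the `N`-transitions made up to time `t` with four other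
such sums `∑ v i`; here `N` is the larger of the orders of `a` and `b`, `u` and three of the `v i`
are indicators that two sensors are on, and the fourth `v i` is the constant threshold. The true
implication makes the same comparison between stationary means. So if the mean of `u` differs from
all the others, a disagreement forces some sum of `u - v i` or `v i - u` to be nonnegative although
its mean is negative. If there is a tie and none of the inequalities fails strictly, the tie is at
level `0`; then one of the `v i` has mean `0`, so it vanishes along every trajectory that the
actions allow, since these have positive stationary probability, and there is no empirical edge
either (`expRare_not_forall_sum_lt_iff`).

The chain may be periodic, so there is in general no convergence in law. Its functionals are
controlled through the Poisson equation instead. By the maximum principle, harmonic functions of the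
chain of `N`-transitions are constant (`eq_of_actionMean_eq`): although that chain need not be
irreducible, one transition can be reached from every other. By linear algebra every function `f`
then equals its stationary mean plus `G - actionMean act G` for some `G` (`exists_poisson`), which,
applied to the chain of states, also gives the uniqueness of the stationary distribution. Thus
`∑ (f - mean f)` is a martingale with bounded increments, up to a bounded term, and the exponential moment
method gives exponential decay of the probability that `∑ f ≥ 0` when `f` has negative mean
(`expRare_of_pathMean_neg`). The constants depend only on `G` and `f`, not on the walk.

The expected error is bounded by the probability that the error does not vanish, and almost sure
convergence follows by Borel–Cantelli.
-/

open BinaryAgent MeasureTheory Filter Topology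

namespace BinaryAgent

/-! ### Averages over a uniformly random action, and the Poisson equation -/

section Averages

variable {A Y : Type*} [Fintype A]

/-- The averaging operator of the chain that applies a uniformly random action:
`(actionMean act G) y` is the mean of `G (act a y)` over all actions `a`. -/
noncomputable def actionMean (act : A → Y → Y) : (Y → ℝ) →ₗ[ℝ] (Y → ℝ) where
  toFun G y := (∑ a, G (act a y)) / Fintype.card A
  map_add' G H := by
    ext y
    simp [Finset.sum_add_distrib, add_div]
  map_smul' c G := by
    ext y
    simp [← Finset.mul_sum, mul_div_assoc]

theorem actionMean_apply (act : A → Y → Y) (G : Y → ℝ) (y : Y) :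
    actionMean act G y = (∑ a, G (act a y)) / Fintype.card A := rfl

theorem actionMean_const [Nonempty A] (act : A → Y → Y) (c : ℝ) :
    actionMean act (fun _ => c) = fun _ => c := by
  ext y
  simp [actionMean_apply]

/-- The maximum principle, propagated along actions. -/
theorem le_of_actionMean_eq [Nonempty A] [Finite Y] {act : A → Y → Y} {y₀ : Y}
    (hy₀ : ∀ y, Relation.ReflTransGen (Step act) y y₀) {G : Y → ℝ}
    (hG : actionMean act G = G) (y : Y) : G y ≤ G y₀ := by
  have : Nonempty Y := ⟨y⟩
  obtain ⟨m, hm⟩ := Finite.exists_max G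
  have key : ∀ z, Relation.ReflTransGen (Step act) m z → G z = G m := by
    intro z hz
    induction hz with
    | refl => rfl
    | @tail b c _ hbc ih =>
      obtain ⟨a, rfl⟩ := hbc
      have h0 : ∑ a, (G m - G (act a b)) = 0 := by
        have h1 := congrFun hG b
        rw [actionMean_apply, ih, div_eq_iff (by simp)] at h1
        rw [Finset.sum_sub_distrib, h1]
        simp [mul_comm]
      have h2 := (Finset.sum_eq_zero_iff_of_nonneg
        (fun a _ => sub_nonneg.2 (hm (act a b)))).1 h0 a (Finset.mem_univ _)
      linarith
  rw [key y₀ (hy₀ m)]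
  exact hm y

/-- If some state can be reached from every state, then harmonic functions are constant. -/
theorem eq_of_actionMean_eq [Nonempty A] [Finite Y] {act : A → Y → Y} {y₀ : Y}
    (hy₀ : ∀ y, Relation.ReflTransGen (Step act) y y₀) {G : Y → ℝ}
    (hG : actionMean act G = G) (y : Y) : G y = G y₀ := by
  refine le_antisymm (le_of_actionMean_eq hy₀ hG y) ?_
  have := le_of_actionMean_eq hy₀ (G := -G) (by rw [map_neg, hG]) y
  simpa using this

/-- Solvability of the Poisson equation: modulo its mean `ℓ f` under an invariant functional, every
function `f` is of the form `G - actionMean act G`. -/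
theorem exists_poisson [Nonempty A] [Finite Y] {act : A → Y → Y} {y₀ : Y}
    (hy₀ : ∀ y, Relation.ReflTransGen (Step act) y y₀) (ℓ : (Y → ℝ) →ₗ[ℝ] ℝ)
    (hℓ : ∀ G, ℓ (actionMean act G) = ℓ G) (hℓ1 : ℓ (fun _ => 1) = 1) (f : Y → ℝ) :
    ∃ G : Y → ℝ, ∀ y, f y = ℓ f + (G y - actionMean act G y) := by
  -- The rank-one perturbation `G ↦ G - actionMean act G + ℓ G` is injective, hence surjective.
  let L : (Y → ℝ) →ₗ[ℝ] (Y → ℝ) :=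
    LinearMap.id - actionMean act + ℓ.smulRight (fun _ => (1 : ℝ))
  have hL : ∀ G, L G = G - actionMean act G + ℓ G • (fun _ => (1 : ℝ)) := fun G => rfl
  have hLℓ : ∀ G, ℓ (L G) = ℓ G := by
    intro G
    rw [hL, map_add, map_sub, hℓ, map_smul, hℓ1]
    simp
  have hinj : Function.Injective L := by
    rw [injective_iff_map_eq_zero]
    intro G hG
    have h0 : ℓ G = 0 := by rw [← hLℓ, hG, map_zero]
    have h1 : actionMean act G = G := by
      have := hL G
      rw [hG, h0, zero_smul, add_zero] at this
      exact (sub_eq_zero.1 this.symm).symm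
    have h2 : G = G y₀ • (fun _ => (1 : ℝ)) := by
      ext y
      simpa using eq_of_actionMean_eq hy₀ h1 y
    rw [h2, map_smul, hℓ1] at h0
    rw [h2]
    ext y
    simpa using h0
  obtain ⟨G, hG⟩ := (LinearMap.injective_iff_surjective.1 hinj) f
  refine ⟨G, fun y => ?_⟩
  have h1 : ℓ f = ℓ G := by rw [← hG, hLℓ]
  have h2 := congrFun hG y
  rw [hL] at h2
  simp only [Pi.add_apply, Pi.sub_apply, Pi.smul_apply, smul_eq_mul, mul_one] at h2
  rw [h1]
  linarith

end Averages

/-! ### Stationary distributions -/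

section Stationary

variable {X A : Type*} [Fintype X] [Fintype A] {act : A → X → X}

theorem sum_transitionMatrix_mul (act : A → X → X) (x : X) (G : X → ℝ) :
    ∑ y, transitionMatrix act x y * G y = actionMean act G x := by
  classical
  have h : ∀ y, (Nat.card {i : A // act i x = y} : ℝ) = ∑ i, if act i x = y then 1 else 0 := by
    intro y
    rw [Nat.card_eq_fintype_card, Fintype.card_subtype, Finset.card_filter]
    push_cast
    rfl
  simp only [transitionMatrix, h, actionMean_apply, div_mul_eq_mul_div, Finset.sum_mul,
    ← Finset.sum_div]
  rw [Finset.sum_comm]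
  simp

theorem sum_transitionMatrix [Nonempty A] (act : A → X → X) (x : X) :
    ∑ y, transitionMatrix act x y = 1 := by
  simpa [actionMean_const] using sum_transitionMatrix_mul act x (fun _ => 1)

omit [Fintype X] in
theorem transitionMatrix_nonneg (act : A → X → X) (x y : X) : 0 ≤ transitionMatrix act x y := by
  unfold transitionMatrix
  positivity

omit [Fintype X] in
theorem transitionMatrix_pos {x y : X} (h : Step act x y) : 0 < transitionMatrix act x y := by
  obtain ⟨i, hi⟩ := h
  have : Nonempty A := ⟨i⟩
  have : Nonempty {i : A // act i x = y} := ⟨⟨i, hi⟩⟩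
  have : 0 < Nat.card {i : A // act i x = y} := Nat.card_pos
  unfold transitionMatrix
  positivity

theorem IsStationary.sum_mul_actionMean {π : X → ℝ} (hπ : IsStationary act π) (G : X → ℝ) :
    ∑ x, π x * actionMean act G x = ∑ x, π x * G x := by
  have h := hπ.2
  calc ∑ x, π x * actionMean act G x
      = ∑ x, ∑ y, π x * (transitionMatrix act x y * G y) := by
        simp_rw [← sum_transitionMatrix_mul, Finset.mul_sum]
    _ = ∑ y, (Matrix.vecMul π (transitionMatrix act) y) * G y := by
        rw [Finset.sum_comm]
        simp [Matrix.vecMul, dotProduct, Finset.sum_mul, mul_assoc]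
    _ = ∑ x, π x * G x := by rw [h]

/-- A left fixed vector of the transition matrix exists because constants are right fixed vectors;
its absolute value is again a left fixed vector, since the matrix preserves total mass. -/
theorem exists_isStationary [Nonempty X] [Nonempty A] (act : A → X → X) :
    ∃ π : X → ℝ, IsStationary act π := by
  classical
  let P : Matrix X X ℝ := transitionMatrix act
  have hdet : (P - 1).det = 0 := by
    rw [← Matrix.exists_mulVec_eq_zero_iff]
    refine ⟨fun _ => 1, fun h => ?_, ?_⟩
    · obtain ⟨x⟩ := ‹Nonempty X›
      exact one_ne_zero (congrFun h x)
    · ext x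
      have := sum_transitionMatrix act x
      rw [Matrix.sub_mulVec, Matrix.one_mulVec]
      simp [Matrix.mulVec, dotProduct, P, this]
  obtain ⟨v, hv0, hv⟩ := Matrix.exists_vecMul_eq_zero_iff.2 hdet
  have hvP : Matrix.vecMul v P = v := by
    rwa [Matrix.vecMul_sub, Matrix.vecMul_one, sub_eq_zero] at hv
  have hle : ∀ y, |v y| ≤ ∑ x, |v x| * P x y := by
    intro y
    calc |v y| = |∑ x, v x * P x y| := by
          conv_lhs => rw [← hvP]
          rfl
      _ ≤ ∑ x, |v x * P x y| := Finset.abs_sum_le_sum_abs _ _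
      _ = ∑ x, |v x| * P x y := by
          refine Finset.sum_congr rfl fun x _ => ?_
          rw [abs_mul, abs_of_nonneg (transitionMatrix_nonneg act x y)]
  have hsum : ∑ y, |v y| = ∑ y, ∑ x, |v x| * P x y := by
    rw [Finset.sum_comm]
    refine Finset.sum_congr rfl fun x _ => ?_
    rw [← Finset.mul_sum, sum_transitionMatrix, mul_one]
  have heq := (Finset.sum_eq_sum_iff_of_le (fun y _ => hle y)).1 hsum
  have hpos : 0 < ∑ y, |v y| := by
    obtain ⟨x, hx⟩ := Function.ne_iff.1 hv0
    exact Finset.sum_pos' (fun _ _ => abs_nonneg _) ⟨x, Finset.mem_univ _, abs_pos.2 hx⟩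
  refine ⟨fun x => |v x| / ∑ y, |v y|, ⟨fun x => by positivity, ?_⟩, ?_⟩
  · rw [← Finset.sum_div, div_self hpos.ne']
  · ext y
    change ∑ x, |v x| / (∑ y, |v y|) * P x y = _
    rw [heq y (Finset.mem_univ _), Finset.sum_div]
    exact Finset.sum_congr rfl fun x _ => by ring

theorem IsStationary.eq [Nonempty A] {x₀ : X}
    (hx₀ : ∀ x, Relation.ReflTransGen (Step act) x x₀) {π π' : X → ℝ}
    (hπ : IsStationary act π) (hπ' : IsStationary act π') : π = π' := by
  classical
  ext x
  let ℓ : (X → ℝ) →ₗ[ℝ] ℝ := Fintype.linearCombination ℝ π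
  have hℓ : ∀ G, ℓ G = ∑ x, π x * G x := fun G => by
    simp [ℓ, Fintype.linearCombination_apply, mul_comm]
  obtain ⟨G, hG⟩ := exists_poisson hx₀ ℓ
    (fun G => by rw [hℓ, hℓ, hπ.sum_mul_actionMean]) (by rw [hℓ]; simpa using hπ.1.2)
    (Pi.single x 1)
  have h1 : ∑ y, π' y * (Pi.single x 1 : X → ℝ) y = ℓ (Pi.single x 1) := by
    simp_rw [hG, mul_add, mul_sub, Finset.sum_add_distrib, Finset.sum_sub_distrib,
      hπ'.sum_mul_actionMean, sub_self, add_zero, ← Finset.sum_mul, hπ'.1.2, one_mul]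
  rw [hℓ] at h1
  simpa [Pi.single_apply] using h1.symm

theorem IsStationary.pos (hreach : ∀ x y, Relation.ReflTransGen (Step act) x y) {π : X → ℝ}
    (hπ : IsStationary act π) (x : X) : 0 < π x := by
  obtain ⟨z, hz⟩ : ∃ z, 0 < π z := by
    by_contra! h
    have := hπ.1.2
    have h2 : ∑ x, π x ≤ 0 := Finset.sum_nonpos fun x _ => h x
    linarith
  induction hreach z x with
  | refl => exact hz
  | @tail b c _ hbc ih =>
    have h : Matrix.vecMul π (transitionMatrix act) c = π c := congrFun hπ.2 c
    rw [← h]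
    exact lt_of_lt_of_le (mul_pos ih (transitionMatrix_pos hbc))
      (Finset.single_le_sum (f := fun x => π x * transitionMatrix act x c)
        (fun x _ => mul_nonneg (hπ.1.1 x) (transitionMatrix_nonneg act x c)) (Finset.mem_univ b))

omit [Fintype X] [Fintype A] in
/-- In a connected reversible system of actions every state can be reached from every state. -/
theorem reflTransGen_step (hrev : Reversible act)
    (hconn : (SimpleGraph.fromRel (Step act)).Connected) (x y : X) :
    Relation.ReflTransGen (Step act) x y := by
  refine Relation.ReflTransGen.mono ?_ _ _
    ((SimpleGraph.reachable_iff_reflTransGen _ _).1 (hconn.preconnected x y))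
  rintro u v ⟨_, h | h⟩
  · exact h
  · exact (hrev _ _).2 h

theorem existsUnique_isStationary [Nonempty X] [Nonempty A]
    (hreach : ∀ x y, Relation.ReflTransGen (Step act) x y) :
    ∃! π : X → ℝ, IsStationary act π := by
  have x₀ := Classical.arbitrary X
  obtain ⟨π, hπ⟩ := exists_isStationary act
  exact ⟨π, hπ, fun π' hπ' => hπ'.eq (fun x => hreach x x₀) hπ⟩

end Stationary

/-! ### The chain of transitions -/

section Paths

variable {X A : Type*} {act : A → X → X}

/-- The action on `N`-transitions induced by an action on states: the oldest state is dropped and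
the image of the latest state is appended. -/
def pathAct (act : A → X → X) {N : ℕ} (a : A) (x : Fin (N + 1) → X) : Fin (N + 1) → X :=
  Fin.snoc (α := fun _ => X) (Fin.tail x) (act a (x (Fin.last N)))

theorem pathAct_last {N : ℕ} (a : A) (x : Fin (N + 1) → X) :
    pathAct act a x (Fin.last N) = act a (x (Fin.last N)) := by
  simp [pathAct]

theorem pathAct_castSucc {N : ℕ} (a : A) (x : Fin (N + 1) → X) (i : Fin N) :
    pathAct act a x i.castSucc = x i.succ := by
  simp [pathAct, Fin.tail]

theorem transition_add_one {φ : ℤ → X} {t : ℤ} {a : A} (h : φ (t + 1) = act a (φ t)) (N : ℕ) :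
    transition φ N (t + 1) = pathAct act a (transition φ N t) := by
  ext i
  refine Fin.lastCases ?_ (fun i => ?_) i
  · rw [pathAct_last]
    simp [transition, h]
  · rw [pathAct_castSucc]
    simp only [transition, Fin.val_castSucc, Fin.val_succ]
    congr 1
    push_cast
    ring

theorem iterate_pathAct_apply {N : ℕ} (a : A) (x : Fin (N + 1) → X) (k : ℕ) (i : Fin (N + 1))
    (hi : N ≤ i + k) :
    (pathAct act a)^[k] x i = (act a)^[i + k - N] (x (Fin.last N)) := by
  induction k generalizing i with
  | zero =>
    obtain rfl : i = Fin.last N := Fin.ext (by have := i.2; simp; omega)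
    simp
  | succ k ih =>
    rw [Function.iterate_succ_apply']
    induction i using Fin.lastCases with
    | last =>
      rw [pathAct_last, ih _ (by simp)]
      simp only [Fin.val_last, Nat.add_sub_cancel_left]
      rw [Function.iterate_succ_apply']
    | cast i =>
      simp only [Fin.val_castSucc] at hi
      rw [pathAct_castSucc, ih _ (by simp; omega)]
      simp only [Fin.val_castSucc, Fin.val_succ]
      congr 2
      omega

theorem reflTransGen_iterate (a : A) (x : X) (k : ℕ) :
    Relation.ReflTransGen (Step act) x ((act a)^[k] x) := by
  induction k with
  | zero => exact .refl
  | succ k ih =>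
    rw [Function.iterate_succ_apply']
    exact ih.tail ⟨a, rfl⟩

/-- Some transition can be reached from every transition: the one made by repeating a fixed action
from a fixed state. -/
theorem exists_forall_reflTransGen_pathAct [Nonempty A] {x₀ : X}
    (hx₀ : ∀ x, Relation.ReflTransGen (Step act) x x₀) (N : ℕ) :
    ∃ z : Fin (N + 1) → X, ∀ x, Relation.ReflTransGen (Step (pathAct act)) x z := by
  obtain ⟨a⟩ := ‹Nonempty A›
  refine ⟨fun i => (act a)^[i] x₀, fun x => ?_⟩
  obtain ⟨y, hxy, hy⟩ : ∃ y : Fin (N + 1) → X,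
      Relation.ReflTransGen (Step (pathAct act)) x y ∧ y (Fin.last N) = x₀ := by
    have hr := hx₀ (x (Fin.last N))
    clear hx₀
    induction hr with
    | refl => exact ⟨x, .refl, rfl⟩
    | tail _ hbc ih =>
      obtain ⟨y, hxy, hy⟩ := ih
      obtain ⟨b, hb⟩ := hbc
      exact ⟨pathAct act b y, hxy.tail ⟨b, rfl⟩, by rw [pathAct_last, hy, hb]⟩
  refine hxy.trans ?_
  convert reflTransGen_iterate a y N using 1
  ext i
  rw [iterate_pathAct_apply a y N i (by omega), hy, Nat.add_sub_cancel]

variable [Fintype X] [Fintype A]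

omit [Fintype X] in
theorem pathProb_nonneg {π : X → ℝ} (hπ : ∀ x, 0 ≤ π x) {N : ℕ} (x : Fin (N + 1) → X) :
    0 ≤ pathProb act π x :=
  mul_nonneg (hπ _) (Finset.prod_nonneg fun _ _ => transitionMatrix_nonneg act _ _)

/-- The mean of a function of the `N`-transition under the stationary chain. -/
noncomputable def pathMean (act : A → X → X) (π : X → ℝ) (N : ℕ) :
    ((Fin (N + 1) → X) → ℝ) →ₗ[ℝ] ℝ :=
  Fintype.linearCombination ℝ (pathProb act π)

theorem pathMean_apply (π : X → ℝ) {N : ℕ} (f : (Fin (N + 1) → X) → ℝ) :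
    pathMean act π N f = ∑ x, pathProb act π x * f x := by
  simp [pathMean, Fintype.linearCombination_apply, mul_comm]

omit [Fintype X] in
theorem pathProb_snoc (π : X → ℝ) {N : ℕ} (x : Fin (N + 1) → X) (y : X) :
    pathProb act π (Fin.snoc (α := fun _ => X) x y : Fin (N + 2) → X) =
      pathProb act π x * transitionMatrix act (x (Fin.last N)) y := by
  have h0 : (Fin.snoc (α := fun _ => X) x y : Fin (N + 2) → X) 0 = x 0 := by
    rw [← Fin.castSucc_zero, Fin.snoc_castSucc]
  rw [pathProb, pathProb, Fin.prod_univ_castSucc, h0, mul_assoc]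
  congr 2
  · refine Finset.prod_congr rfl fun i _ => ?_
    rw [Fin.snoc_castSucc, Fin.succ_castSucc, Fin.snoc_castSucc]
  · rw [Fin.snoc_castSucc, Fin.succ_last, Fin.snoc_last]

theorem IsStationary.sum_pathProb_cons {π : X → ℝ} (hπ : IsStationary act π) {N : ℕ}
    (x : Fin (N + 1) → X) :
    ∑ y, pathProb act π (Fin.cons (α := fun _ => X) y x : Fin (N + 2) → X) =
      pathProb act π x := by
  have h : Matrix.vecMul π (transitionMatrix act) (x 0) = π (x 0) := congrFun hπ.2 _
  simp only [pathProb, Fin.prod_univ_succ (n := N), Fin.cons_zero, Fin.castSucc_zero,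
    Fin.cons_succ, ← Fin.succ_castSucc]
  rw [← h]
  simp only [Matrix.vecMul, dotProduct, Finset.sum_mul, mul_assoc]

/-- The law of the transitions of the stationary chain is invariant. -/
theorem IsStationary.pathMean_actionMean {π : X → ℝ} (hπ : IsStationary act π) {N : ℕ}
    (f : (Fin (N + 1) → X) → ℝ) :
    pathMean act π N (actionMean (pathAct act) f) = pathMean act π N f := by
  have hmean : ∀ x : Fin (N + 1) → X, actionMean (pathAct act) f x =
      ∑ y, transitionMatrix act (x (Fin.last N)) y *
        f (Fin.snoc (α := fun _ => X) (Fin.tail x) y) := by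
    intro x
    rw [sum_transitionMatrix_mul]
    rfl
  have htail : ∀ (x : Fin (N + 1) → X) (y : X),
      (Fin.snoc (α := fun _ => X) (Fin.tail x) y : Fin (N + 1) → X) =
        Fin.tail (Fin.snoc (α := fun _ => X) x y : Fin (N + 2) → X) := by
    intro x y
    ext i
    induction i using Fin.lastCases with
    | last => rw [Fin.snoc_last, Fin.tail, Fin.succ_last, Fin.snoc_last]
    | cast i =>
      rw [Fin.snoc_castSucc, Fin.tail, Fin.tail, Fin.succ_castSucc, Fin.snoc_castSucc]
  rw [pathMean_apply, pathMean_apply]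
  calc ∑ x, pathProb act π x * actionMean (pathAct act) f x
      = ∑ x : Fin (N + 1) → X, ∑ y,
          pathProb act π (Fin.snoc (α := fun _ => X) x y : Fin (N + 2) → X) *
            f (Fin.tail (Fin.snoc (α := fun _ => X) x y : Fin (N + 2) → X)) := by
        simp_rw [hmean, pathProb_snoc, Finset.mul_sum, htail, mul_assoc]
    _ = ∑ z : Fin (N + 2) → X, pathProb act π z * f (Fin.tail z) := by
        rw [Finset.sum_comm, ← Fintype.sum_prod_type']
        exact (Fin.snocEquiv (fun _ : Fin (N + 2) => X)).sum_comp
          (fun z : Fin (N + 2) → X => pathProb act π z * f (Fin.tail z))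
    _ = ∑ x : Fin (N + 1) → X, ∑ y,
          pathProb act π (Fin.cons (α := fun _ => X) y x : Fin (N + 2) → X) * f x := by
        rw [Finset.sum_comm, ← Fintype.sum_prod_type']
        rw [← (Fin.consEquiv (fun _ : Fin (N + 2) => X)).sum_comp]
        simp [Fin.consEquiv]
    _ = ∑ x, pathProb act π x * f x := by
        simp_rw [← Finset.sum_mul, hπ.sum_pathProb_cons]

theorem IsStationary.pathMean_one [Nonempty A] {π : X → ℝ} (hπ : IsStationary act π) (N : ℕ) :
    pathMean act π N (fun _ => 1) = 1 := by
  induction N with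
  | zero =>
    rw [pathMean_apply, ← (Equiv.funUnique (Fin 1) X).symm.sum_comp]
    simpa [pathProb] using hπ.1.2
  | succ N ih =>
    refine Eq.trans ?_ ih
    rw [pathMean_apply, pathMean_apply, ← (Fin.consEquiv (fun _ : Fin (N + 2) => X)).sum_comp,
      Fintype.sum_prod_type, Finset.sum_comm]
    simp only [mul_one]
    exact Finset.sum_congr rfl fun x _ => hπ.sum_pathProb_cons x

omit [Fintype X] in
theorem pathProb_transition_pos {π : X → ℝ} (hπ : ∀ x, 0 < π x) {φ : ℤ → X}
    (hφ : ∀ s, Step act (φ s) (φ (s + 1))) (N : ℕ) (t : ℤ) :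
    0 < pathProb act π (transition φ N t) := by
  refine mul_pos (hπ _) (Finset.prod_pos fun i _ => transitionMatrix_pos ?_)
  have h := hφ (t - N + (i : ℕ))
  simpa [transition, add_assoc] using h

/-- A nonnegative function with vanishing stationary mean vanishes along all trajectories that the
actions allow, because such trajectories run through transitions of positive probability only. -/
theorem apply_transition_eq_zero (hreach : ∀ x y, Relation.ReflTransGen (Step act) x y)
    {π : X → ℝ} (hπ : IsStationary act π) {N : ℕ} {v : (Fin (N + 1) → X) → ℝ} (hv : ∀ x, 0 ≤ v x)
    (hv0 : pathMean act π N v = 0) {ψ : ℤ → X} (hψ : ∀ s, Step act (ψ s) (ψ (s + 1))) (t : ℤ) :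
    v (transition ψ N t) = 0 := by
  rw [pathMean_apply, Finset.sum_eq_zero_iff_of_nonneg
    fun x _ => mul_nonneg (pathProb_nonneg hπ.1.1 x) (hv x)] at hv0
  exact (mul_eq_zero.1 (hv0 _ (Finset.mem_univ _))).resolve_left
    (pathProb_transition_pos (hπ.pos hreach) hψ N t).ne'

end Paths

/-! ### Exponentially rare events -/

section Concentration

variable {X A : Type*} [Fintype A] [MeasurableSpace X] [MeasurableSpace A] {act : A → X → X}

/-- The events `E t` on trajectories have exponentially decaying probabilities, with constants that
do not depend on the random walk. No measurability is required: `μ` is an outer measure here. -/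
def ExpRare.{u} (act : A → X → X) (E : ℕ → Set (ℤ → X)) : Prop :=
  ∃ C c : ℝ, 0 < c ∧ ∀ (Ω : Type u) [MeasurableSpace Ω] (μ : Measure Ω) [IsProbabilityMeasure μ]
    (φ : ℤ → Ω → X) (α : ℤ → Ω → A), IsRandomWalk μ act φ α →
    ∀ t : ℕ, μ.real {ω | (fun s => φ s ω) ∈ E t} ≤ C * Real.exp (-c * t)

theorem IsRandomWalk.ae_step {Ω : Type*} [MeasurableSpace Ω] {μ : Measure Ω} {φ : ℤ → Ω → X}
    {α : ℤ → Ω → A} (hw : IsRandomWalk μ act φ α) :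
    ∀ᵐ ω ∂μ, ∀ s, Step act (φ s ω) (φ (s + 1) ω) := by
  rw [ae_all_iff]
  intro s
  filter_upwards [hw.step s] with ω hω
  exact ⟨_, hω.symm⟩

/-- Only trajectories that the actions allow matter for rarity. -/
theorem ExpRare.mono.{u} {E E' : ℕ → Set (ℤ → X)} (hE : ExpRare.{_, _, u} act E)
    (h : ∀ t ψ, (∀ s, Step act (ψ s) (ψ (s + 1))) → ψ ∈ E' t → ψ ∈ E t) :
    ExpRare.{_, _, u} act E' := by
  obtain ⟨C, c, hc, H⟩ := hE
  refine ⟨C, c, hc, fun Ω _ μ _ φ α hw t => le_trans ?_ (H Ω μ φ α hw t)⟩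
  refine ENNReal.toReal_mono (measure_ne_top _ _) (measure_mono_ae ?_)
  filter_upwards [hw.ae_step] with ω hω
  exact h t (fun s => φ s ω) hω

theorem ExpRare.empty : ExpRare act (fun _ => (∅ : Set (ℤ → X))) :=
  ⟨0, 1, one_pos, fun Ω _ μ _ φ α _ t => by simp⟩

theorem ExpRare.iUnion.{u} {ι : Type*} [Finite ι] {E : ι → ℕ → Set (ℤ → X)}
    (hE : ∀ i, ExpRare.{_, _, u} act (E i)) : ExpRare.{_, _, u} act (fun t => ⋃ i, E i t) := by
  have := Fintype.ofFinite ι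
  choose C c hc H using hE
  obtain ⟨d, hd, hd0⟩ : ∃ d, (∀ i, d ≤ c i) ∧ 0 < d := by
    have h1 : ∀ᶠ d in 𝓝[>] (0 : ℝ), ∀ i, d ≤ c i := by
      rw [eventually_all]
      exact fun i => nhdsWithin_le_nhds (eventually_le_nhds (hc i))
    exact (h1.and self_mem_nhdsWithin).exists
  refine ⟨∑ i, |C i|, d, hd0, fun Ω _ μ _ φ α hw t => ?_⟩
  have hset : {ω | (fun s => φ s ω) ∈ ⋃ i, E i t} = ⋃ i, {ω | (fun s => φ s ω) ∈ E i t} := by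
    ext ω
    simp
  rw [hset, Finset.sum_mul]
  refine (measureReal_iUnion_fintype_le _).trans (Finset.sum_le_sum fun i _ => ?_)
  calc _ ≤ C i * Real.exp (-c i * t) := H i Ω μ φ α hw t
    _ ≤ |C i| * Real.exp (-c i * t) := by gcongr; exact le_abs_self _
    _ ≤ |C i| * Real.exp (-d * t) := by gcongr; exact hd i

/-! ### Concentration of additive functionals -/

variable [DiscreteMeasurableSpace A]

/-- Averaging over the next action, which is uniform and independent of the past. -/
theorem IsRandomWalk.integral_action {Ω : Type*} [MeasurableSpace Ω] {μ : Measure Ω}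
    [IsProbabilityMeasure μ] {φ : ℤ → Ω → X}
    {α : ℤ → Ω → A} (hw : IsRandomWalk μ act φ α) {s : ℤ} (hs : 0 ≤ s) {K : A → (ℤ → X) → ℝ}
    (hKm : ∀ a, Measurable (K a))
    (hKd : ∀ a ψ ψ', (∀ r ≤ s, ψ r = ψ' r) → K a ψ = K a ψ')
    (hKi : ∀ a, Integrable (fun ω => K a (fun r => φ r ω)) μ) :
    ∫ ω, K (α s ω) (fun r => φ r ω) ∂μ =
      ∫ ω, (∑ a, K a (fun r => φ r ω)) / Fintype.card A ∂μ := by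
  classical
  have hind : ∀ a, Measurable (fun ω => if α s ω = a then (1 : ℝ) else 0) := fun a =>
    (Measurable.of_discrete (f := fun i => if i = a then (1 : ℝ) else 0)).comp
      (hw.measurable_action s)
  -- A trajectory up to time `s` is extended by its final value, to be fed into `K a`.
  let ext : (Set.Iic s → X) → ℤ → X := fun h r => h ⟨min r s, min_le_right r s⟩
  have hext : Measurable ext := measurable_pi_lambda _ fun r => measurable_pi_apply _
  have hKext : ∀ a ω, K a (ext (fun r : Set.Iic s => φ r ω)) = K a (fun r => φ r ω) := by
    intro a ω
    refine hKd a _ _ fun r hr => ?_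
    simp [ext, min_eq_left hr]
  have hprod : ∀ a, ∫ ω, (if α s ω = a then (1 : ℝ) else 0) * K a (fun r => φ r ω) ∂μ =
      (Fintype.card A : ℝ)⁻¹ * ∫ ω, K a (fun r => φ r ω) ∂μ := by
    intro a
    have h1 := (hw.indep s hs).comp
      (Measurable.of_discrete (f := fun i => if i = a then (1 : ℝ) else 0)) ((hKm a).comp hext)
    have h2 : ((K a ∘ ext) ∘ fun ω (r : Set.Iic s) => φ r ω) = fun ω => K a (fun r => φ r ω) :=
      funext fun ω => hKext a ω
    rw [h2] at h1
    rw [show (fun ω => (if α s ω = a then (1 : ℝ) else 0) * K a (fun r => φ r ω)) =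
      fun ω => ((fun i => if i = a then (1 : ℝ) else 0) ∘ α s) ω * K a (fun r => φ r ω) from rfl,
      h1.integral_fun_mul_eq_mul_integral (hind a).aestronglyMeasurable
        (hKi a).aestronglyMeasurable]
    congr 1
    have h3 : ((fun i => if i = a then (1 : ℝ) else 0) ∘ α s) =
        Set.indicator {ω | α s ω = a} (fun _ => 1) := by
      ext ω
      simp [Set.indicator_apply]
    rw [h3, integral_indicator_const (s := {ω | α s ω = a}) _
      (hw.measurable_action s (MeasurableSet.of_discrete (s := {a}))), measureReal_def,
      hw.uniform s hs a]
    simp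
  have hsum : ∀ ω, K (α s ω) (fun r => φ r ω) =
      ∑ a, (if α s ω = a then (1 : ℝ) else 0) * K a (fun r => φ r ω) := by
    intro ω
    simp
  simp_rw [hsum]
  rw [integral_finsetSum _ fun a _ => ?_, integral_div, integral_finsetSum _ fun a _ => hKi a,
    Finset.sum_congr rfl fun a _ => hprod a, ← Finset.mul_sum, div_eq_inv_mul]
  refine (hKi a).bdd_mul (c := 1) (hind a).aestronglyMeasurable (ae_of_all _ fun ω => ?_)
  split_ifs <;> simp

omit [MeasurableSpace A] [DiscreteMeasurableSpace A] in
/-- A bound on the exponential moments of a centered bounded variable. -/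
theorem sum_exp_div_card_le [Nonempty A] {d : A → ℝ} {D r : ℝ} (hd0 : ∑ a, d a = 0)
    (hd : ∀ a, |d a| ≤ D) (hr : 0 ≤ r) (hrD : r * D ≤ 1) :
    (∑ a, Real.exp (r * d a)) / Fintype.card A ≤ Real.exp ((r * D) ^ 2) := by
  have h1 : ∀ a, Real.exp (r * d a) ≤ 1 + r * d a + (r * D) ^ 2 := by
    intro a
    have h2 : |r * d a| ≤ r * D := by
      rw [abs_mul, abs_of_nonneg hr]
      exact mul_le_mul_of_nonneg_left (hd a) hr
    have h3 := (le_abs_self _).trans (Real.abs_exp_sub_one_sub_id_le (h2.trans hrD))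
    have h4 : (r * d a) ^ 2 ≤ (r * D) ^ 2 := sq_le_sq' (abs_le.1 h2).1 (abs_le.1 h2).2
    linarith
  have h5 : (0 : ℝ) < Fintype.card A := by positivity
  calc (∑ a, Real.exp (r * d a)) / Fintype.card A
      ≤ (∑ a, (1 + r * d a + (r * D) ^ 2)) / Fintype.card A := by
        gcongr with a
        exact h1 a
    _ = (r * D) ^ 2 + 1 := by
        rw [Finset.sum_add_distrib, Finset.sum_add_distrib, ← Finset.mul_sum, hd0]
        simp
        field_simp
        ring
    _ ≤ Real.exp ((r * D) ^ 2) := Real.add_one_le_exp _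

omit [Fintype A] [MeasurableSpace A] [DiscreteMeasurableSpace A] in
theorem measurable_transition (N : ℕ) (t : ℤ) :
    Measurable (fun ψ : ℤ → X => transition ψ N t) :=
  measurable_pi_lambda _ fun _ => measurable_pi_apply _

variable [Fintype X] [DiscreteMeasurableSpace X]

/-- An additive functional of the walk with negative stationary drift is nonnegative only with
exponentially small probability. With `G` solving the Poisson equation for `f`, the exponential of
a small multiple of `∑ (f - mean) + G` grows by at most a constant factor close to `1` in the mean
at each step. -/
theorem expRare_of_pathMean_neg.{u} [Nonempty A]
    (hreach : ∀ x y, Relation.ReflTransGen (Step act) x y) {π : X → ℝ}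
    (hπ : IsStationary act π) {N : ℕ} {f : (Fin (N + 1) → X) → ℝ}
    (hf : pathMean act π N f < 0) :
    ExpRare.{_, _, u} act
      (fun t => {ψ | 0 ≤ ∑ k ∈ Finset.range t, f (transition ψ N ((k + 1 : ℕ) : ℤ))}) := by
  classical
  obtain ⟨x₀, -⟩ : ∃ x, 0 < π x := by
    by_contra! h
    have h1 := hπ.1.2
    have h2 : ∑ x, π x ≤ 0 := Finset.sum_nonpos fun x _ => h x
    linarith
  obtain ⟨z, hz⟩ := exists_forall_reflTransGen_pathAct (fun x => hreach x x₀) N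
  obtain ⟨G, hG⟩ := exists_poisson hz (pathMean act π N) (fun G => hπ.pathMean_actionMean G)
    (hπ.pathMean_one N) f
  set m := pathMean act π N f with hm
  set T := actionMean (pathAct act) G with hT
  obtain ⟨B, hB0, hB⟩ : ∃ B : ℝ, 0 < B ∧ ∀ y, |G y| ≤ B := by
    obtain ⟨B, hB⟩ := (Set.finite_range fun y => |G y|).bddAbove
    exact ⟨max B 1, by positivity, fun y => (hB ⟨y, rfl⟩).trans (le_max_left _ _)⟩
  have hcard : (0 : ℝ) < Fintype.card A := by positivity
  have hTB : ∀ y, |T y| ≤ B := by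
    intro y
    rw [hT, actionMean_apply, abs_div, abs_of_pos hcard, div_le_iff₀ hcard]
    refine (Finset.abs_sum_le_sum_abs _ _).trans ((Finset.sum_le_sum fun a _ => hB _).trans ?_)
    simp [mul_comm]
  have hGT : ∀ y y', |G y - T y'| ≤ 2 * B := fun y y' =>
    (abs_sub _ _).trans (by linarith [hB y, hTB y'])
  -- `r` makes the quadratic growth `(2 r B) ^ 2` at most half of the linear drift `-r m`.
  obtain ⟨r, hr0, hr1, hr2⟩ : ∃ r : ℝ, 0 < r ∧ r * (2 * B) ≤ 1 ∧ r * (4 * B ^ 2) ≤ -m / 2 := by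
    refine ⟨min (1 / (2 * B)) (-m / 2 / (4 * B ^ 2)), ?_, ?_, ?_⟩
    · have : 0 < -m / 2 := by linarith
      positivity
    · rw [← le_div_iff₀ (by positivity)]
      exact min_le_left _ _
    · rw [← le_div_iff₀ (by positivity)]
      exact min_le_right _ _
  let Q : ℕ → (ℤ → X) → ℝ := fun t ψ =>
    ∑ k ∈ Finset.range t, (f (transition ψ N ((k + 1 : ℕ) : ℤ)) - m) +
      G (transition ψ N ((t + 1 : ℕ) : ℤ))
  have hfm : ∀ y, f y - m = G y - T y := fun y => by rw [hG y]; ring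
  have hQB : ∀ t ψ, |Q t ψ| ≤ t * (2 * B) + B := by
    intro t ψ
    refine (abs_add_le _ _).trans (add_le_add ((Finset.abs_sum_le_sum_abs _ _).trans ?_) (hB _))
    refine (Finset.sum_le_sum fun k _ => ?_).trans_eq
      (by rw [Finset.sum_const, Finset.card_range, nsmul_eq_mul])
    rw [hfm]
    exact hGT _ _
  have hmeas : ∀ (g : (Fin (N + 1) → X) → ℝ) (s : ℤ),
      Measurable (fun ψ : ℤ → X => g (transition ψ N s)) := fun g s =>
    Measurable.of_discrete.comp (measurable_transition N s)
  have hQm : ∀ t, Measurable (Q t) := fun t =>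
    (Finset.measurable_fun_sum _ fun k _ => (hmeas f _).sub_const m).add (hmeas G _)
  have htr : ∀ {ψ ψ' : ℤ → X} {s s' : ℤ}, (∀ r ≤ s, ψ r = ψ' r) → s' ≤ s →
      transition ψ N s' = transition ψ' N s' := by
    intro ψ ψ' s s' h hs
    ext i
    have := i.2
    exact h _ (by omega)
  refine ⟨Real.exp (2 * (r * B)), -(r * m / 2), by nlinarith, fun Ω _ μ _ φ α hw t => ?_⟩
  have hφm : Measurable (fun ω (s : ℤ) => φ s ω) := measurable_pi_lambda _ hw.measurable_state
  have hint : ∀ {F : (ℤ → X) → ℝ} {D : ℝ}, Measurable F → (∀ ψ, F ψ ≤ D) →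
      Integrable (fun ω => Real.exp (r * F (fun s => φ s ω))) μ := by
    intro F D hF hD
    refine Integrable.of_bound (C := Real.exp (r * D))
      (((hF.comp hφm).const_mul r).exp).aestronglyMeasurable (ae_of_all _ fun ω => ?_)
    rw [Real.norm_eq_abs, Real.abs_exp]
    gcongr
    exact hD _
  have hQi : ∀ t, Integrable (fun ω => Real.exp (r * Q t (fun s => φ s ω))) μ := fun t =>
    hint (hQm t) fun ψ => (le_abs_self _).trans (hQB t ψ)
  -- The supermartingale bound.
  have hM : ∀ t : ℕ, ∫ ω, Real.exp (r * Q t (fun s => φ s ω)) ∂μ ≤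
      Real.exp (r * B + t * (r * (2 * B)) ^ 2) := by
    intro t
    induction t with
    | zero =>
      calc ∫ ω, Real.exp (r * Q 0 (fun s => φ s ω)) ∂μ ≤ ∫ ω, Real.exp (r * B) ∂μ := by
            refine integral_mono (hQi 0) (integrable_const _) fun ω => ?_
            have := (le_abs_self _).trans (hQB 0 (fun s => φ s ω))
            simp only [Nat.cast_zero, zero_mul, zero_add] at this
            gcongr
        _ = _ := by simp
    | succ t ih =>
      let d : A → (ℤ → X) → ℝ := fun a ψ =>
        G (pathAct act a (transition ψ N ((t + 1 : ℕ) : ℤ))) - T (transition ψ N ((t + 1 : ℕ) : ℤ))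
      let K : A → (ℤ → X) → ℝ := fun a ψ => Real.exp (r * (Q t ψ + d a ψ))
      have hKQ : ∀ a, Measurable (fun ψ => Q t ψ + d a ψ) := fun a =>
        (hQm t).add ((hmeas (fun y => G (pathAct act a y)) _).sub (hmeas T _))
      have hKi : ∀ a, Integrable (fun ω => K a (fun s => φ s ω)) μ := fun a =>
        hint (hKQ a) fun ψ => add_le_add ((le_abs_self _).trans (hQB t ψ))
          ((le_abs_self _).trans (hGT _ _))
      have hstep : ∫ ω, Real.exp (r * Q (t + 1) (fun s => φ s ω)) ∂μ =
          ∫ ω, K (α ((t + 1 : ℕ) : ℤ) ω) (fun s => φ s ω) ∂μ := by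
        refine integral_congr_ae ?_
        filter_upwards [hw.step ((t + 1 : ℕ) : ℤ)] with ω hω
        have h1 := transition_add_one (φ := fun s => φ s ω) hω N
        have h2 : ((t + 1 + 1 : ℕ) : ℤ) = ((t + 1 : ℕ) : ℤ) + 1 := by push_cast; ring
        simp only [K, Q, d, Finset.sum_range_succ, h2, h1, hfm]
        congr 2
        ring
      rw [hstep, hw.integral_action (by positivity) (fun a => ((hKQ a).const_mul r).exp) ?_ hKi]
      · calc ∫ ω, (∑ a, K a (fun s => φ s ω)) / Fintype.card A ∂μ
            ≤ ∫ ω, Real.exp ((r * (2 * B)) ^ 2) * Real.exp (r * Q t (fun s => φ s ω)) ∂μ := by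
              refine integral_mono ((integrable_finsetSum _ fun a _ => hKi a).div_const _)
                ((hQi t).const_mul _) fun ω => ?_
              simp only [K, mul_add, Real.exp_add]
              rw [← Finset.mul_sum, mul_div_assoc, mul_comm]
              gcongr
              refine sum_exp_div_card_le ?_ (fun a => hGT _ _) hr0.le hr1
              rw [Finset.sum_sub_distrib, hT, actionMean_apply, Finset.sum_const, nsmul_eq_mul,
                Finset.card_univ, mul_div_cancel₀ _ hcard.ne', sub_self]
          _ ≤ Real.exp ((r * (2 * B)) ^ 2) * Real.exp (r * B + t * (r * (2 * B)) ^ 2) := by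
              rw [integral_const_mul]
              gcongr
          _ = _ := by
              rw [← Real.exp_add]
              congr 1
              push_cast
              ring
      · intro a ψ ψ' h
        have h1 := htr h le_rfl
        simp only [Q, d, h1]
        congr 3
        refine congrArg (· + _) (Finset.sum_congr rfl fun k hk => ?_)
        rw [htr h (by have := Finset.mem_range.1 hk; push_cast; omega)]
  -- Markov's inequality for the exponential moment.
  have hmark := mul_meas_ge_le_integral_of_nonneg (ae_of_all μ fun ω => (Real.exp_pos _).le)
    (hQi t) (Real.exp (r * (-m * t - B)))
  have hsub : {ω | (fun s => φ s ω) ∈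
        {ψ : ℤ → X | 0 ≤ ∑ k ∈ Finset.range t, f (transition ψ N ((k + 1 : ℕ) : ℤ))}} ⊆
      {ω | Real.exp (r * (-m * t - B)) ≤ Real.exp (r * Q t (fun s => φ s ω))} := by
    intro ω hω
    simp only [Set.mem_ofPred_eq] at hω ⊢
    gcongr
    simp only [Q, Finset.sum_sub_distrib, Finset.sum_const, Finset.card_range, nsmul_eq_mul]
    have := (abs_le.1 (hB (transition (fun s => φ s ω) N ((t + 1 : ℕ) : ℤ)))).1
    linarith
  have h1 := (mul_le_mul_of_nonneg_left (measureReal_mono (μ := μ) hsub)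
    (Real.exp_pos (r * (-m * t - B))).le).trans (hmark.trans (hM t))
  rw [← le_div_iff₀' (Real.exp_pos _), ← Real.exp_sub] at h1
  refine h1.trans ?_
  rw [← Real.exp_add]
  gcongr
  have h2 : (t : ℝ) * (r * (r * (4 * B ^ 2))) ≤ t * (r * (-m / 2)) := by gcongr
  nlinarith

end Concentration

/-! ### Snapshots as additive functionals of the walk -/

section SnapshotWeights

variable {X A S : Type*} [InvolutiveStar S] {R : Sensorium X S}

theorem Sensorium.star_mem_observe (R : Sensorium X S) (ψ : ℤ → X) (t : ℤ) (a : S) :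
    star a ∈ R.observe ψ t ↔ a ∉ R.observe ψ t := by
  have h := R.realization_star a (transition ψ (R.order a) t)
  have h1 : (fun i => transition ψ (R.order a) t
      (Fin.cast (congrArg (· + 1) (R.order_star a)) i)) =
      transition ψ (R.order (star a)) t := by
    ext i
    simp [transition, R.order_star a]
  rw [h1] at h
  exact h

theorem Proper.star_right {a b : S} (h : Proper a b) : Proper a (star b) :=
  ⟨h.2, by rw [star_star]; exact h.1⟩

theorem Proper.star_left {a b : S} (h : Proper a b) : Proper (star a) b :=
  ⟨fun h' => h.2 (by rw [← h', star_star]), fun h' => h.1 (star_injective h')⟩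

theorem snapshotAt_threshold (R : Sensorium X S) (T₀ : Snapshot S) (ψ : ℤ → X) (t : ℕ) :
    (snapshotAt R T₀ ψ t).threshold = T₀.threshold := by
  induction t with
  | zero => rfl
  | succ t ih => exact ih

theorem snapshotAt_weight (R : Sensorium X S) (T₀ : Snapshot S) (ψ : ℤ → X) (t : ℕ) (a b : S) :
    (snapshotAt R T₀ ψ t).weight a b = T₀.weight a b + ∑ k ∈ Finset.range t,
      (R.observe ψ ((k + 1 : ℕ) : ℤ)).indicator 1 a *
        (R.observe ψ ((k + 1 : ℕ) : ℤ)).indicator 1 b := by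
  induction t with
  | zero => simp [snapshotAt]
  | succ t ih =>
    rw [Finset.sum_range_succ, ← add_assoc, ← ih]
    rfl

/-- The sensor `a` is on at the end of the `N`-transition `x`. By convention sensors of order
greater than `N` are off. -/
def Sensorium.Fires (R : Sensorium X S) {N : ℕ} (a : S) (x : Fin (N + 1) → X) : Prop :=
  ∃ h : R.order a ≤ N, lastEntries h x ∈ R.realization a

theorem Sensorium.fires_iff {N : ℕ} {a : S} (ha : R.order a ≤ N) (x : Fin (N + 1) → X) :
    R.Fires a x ↔ lastEntries ha x ∈ R.realization a :=
  exists_prop_of_true ha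

open Classical in
/-- The indicator of the `N`-transitions at whose end both `a` and `b` are on. -/
noncomputable def Sensorium.coFire (R : Sensorium X S) (N : ℕ) (a b : S)
    (x : Fin (N + 1) → X) : ℝ :=
  if R.Fires a x ∧ R.Fires b x then 1 else 0

theorem Sensorium.coFire_nonneg (R : Sensorium X S) (N : ℕ) (a b : S) (x : Fin (N + 1) → X) :
    0 ≤ R.coFire N a b x := by
  unfold Sensorium.coFire
  split_ifs <;> simp

theorem Sensorium.fires_transition {N : ℕ} {a : S} (ha : R.order a ≤ N) (ψ : ℤ → X) (t : ℤ) :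
    R.Fires a (transition ψ N t) ↔ a ∈ R.observe ψ t := by
  have h : lastEntries ha (transition ψ N t) = transition ψ (R.order a) t := by
    ext i
    simp only [lastEntries, transition]
    congr 1
    push_cast [Nat.cast_sub ha]
    ring
  rw [Sensorium.fires_iff ha, h]
  rfl

theorem Sensorium.coFire_transition {N : ℕ} {a b : S} (ha : R.order a ≤ N) (hb : R.order b ≤ N)
    (ψ : ℤ → X) (t : ℤ) :
    R.coFire N a b (transition ψ N t) =
      (R.observe ψ t).indicator 1 a * (R.observe ψ t).indicator 1 b := by
  classical
  simp only [Sensorium.coFire, fires_transition ha, fires_transition hb, Set.indicator_apply,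
    Pi.one_apply]
  by_cases h1 : a ∈ R.observe ψ t <;> by_cases h2 : b ∈ R.observe ψ t <;> simp [h1, h2]

theorem snapshotAt_weight_eq_sum_coFire {T₀ : Snapshot S} (hT₀ : T₀.IsTrivial) {a b : S}
    (hab : Proper a b) {N : ℕ} (ha : R.order a ≤ N) (hb : R.order b ≤ N) (ψ : ℤ → X) (t : ℕ) :
    (snapshotAt R T₀ ψ t).weight a b =
      ∑ k ∈ Finset.range t, R.coFire N a b (transition ψ N ((k + 1 : ℕ) : ℤ)) := by
  simp only [snapshotAt_weight, hT₀ a b hab, zero_add, R.coFire_transition ha hb]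

/-- The clock of the snapshot held at time `t` shows `t`. -/
theorem clock_snapshotAt {T₀ : Snapshot S} (hT₀ : T₀.IsTrivial) {a b : S} (hab : Proper a b)
    (ψ : ℤ → X) (t : ℕ) : clock (snapshotAt R T₀ ψ t).weight a b = t := by
  classical
  simp only [clock, snapshotAt_weight, hT₀ a b hab, hT₀ _ _ hab.star_left,
    hT₀ _ _ hab.star_right, hT₀ _ _ hab.star_left.star_right, zero_add,
    ← Finset.sum_add_distrib]
  rw [Finset.sum_congr rfl (g := fun _ => (1 : ℝ)) fun k _ => ?_]
  · simp
  · -- Exactly one of the four pairs made of `a` or `star a` and `b` or `star b` is on.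
    simp only [Set.indicator_apply, R.star_mem_observe, Pi.one_apply]
    generalize R.observe ψ ((k + 1 : ℕ) : ℤ) = O
    by_cases h1 : a ∈ O <;> by_cases h2 : b ∈ O <;> simp [h1, h2]

theorem pathMean_coFire [Fintype X] [Fintype A] {act : A → X → X} {π : X → ℝ} {a b : S} {N : ℕ}
    (hN : N = max (R.order a) (R.order b)) :
    pathMean act π N (R.coFire N a b) = jointProb act π R a b := by
  subst hN
  rw [pathMean_apply, jointProb]
  refine Finset.sum_congr rfl fun x _ => ?_
  have h := and_congr (Sensorium.fires_iff (R := R) (le_max_left (R.order a) (R.order b)) x)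
    (Sensorium.fires_iff (R := R) (le_max_right (R.order a) (R.order b)) x)
  rw [Sensorium.coFire, mul_ite, mul_one, mul_zero]
  by_cases h1 : R.Fires a x ∧ R.Fires b x
  · rw [if_pos h1, if_pos (h.1 h1)]
  · rw [if_neg h1, if_neg (h1 ∘ h.2)]

end SnapshotWeights

/-! ### Empirical implications decide true implications -/

section Comparison

variable {X A S : Type*} [InvolutiveStar S] [Fintype X] [Fintype A] [Nonempty A]
  [MeasurableSpace X] [DiscreteMeasurableSpace X] [MeasurableSpace A] [DiscreteMeasurableSpace A]
  {act : A → X → X}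

theorem expRare_sum_le_sum.{u} (hreach : ∀ x y, Relation.ReflTransGen (Step act) x y) {π : X → ℝ}
    (hπ : IsStationary act π) {N : ℕ} {u v : (Fin (N + 1) → X) → ℝ}
    (huv : pathMean act π N u < pathMean act π N v) :
    ExpRare.{_, _, u} act
      (fun t => {ψ | ∑ k ∈ Finset.range t, v (transition ψ N ((k + 1 : ℕ) : ℤ)) ≤
        ∑ k ∈ Finset.range t, u (transition ψ N ((k + 1 : ℕ) : ℤ))}) := by
  refine (expRare_of_pathMean_neg hreach hπ (f := u - v) (by rw [map_sub]; linarith)).mono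
    fun t ψ _ h => ?_
  simpa [Finset.sum_sub_distrib] using h

/-- Whether the empirical sum of `u` stays below those of all `v i` is decided, outside
exponentially rare events, by the stationary means, provided ties occur at level zero only. -/
theorem expRare_not_forall_sum_lt_iff.{u} (hreach : ∀ x y, Relation.ReflTransGen (Step act) x y)
    {π : X → ℝ} (hπ : IsStationary act π) {N : ℕ} {ι : Type*} [Finite ι]
    {u : (Fin (N + 1) → X) → ℝ} {v : ι → (Fin (N + 1) → X) → ℝ} (hu : ∀ x, 0 ≤ u x)
    (hv : ∀ i x, 0 ≤ v i x)
    (htie : ∀ i, (∀ j, pathMean act π N u ≤ pathMean act π N (v j)) →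
      pathMean act π N u = pathMean act π N (v i) → pathMean act π N u = 0) :
    ExpRare.{_, _, u} act
      (fun t => {ψ | ¬ ((∀ i, ∑ k ∈ Finset.range t, u (transition ψ N ((k + 1 : ℕ) : ℤ)) <
          ∑ k ∈ Finset.range t, v i (transition ψ N ((k + 1 : ℕ) : ℤ))) ↔
        ∀ i, pathMean act π N u < pathMean act π N (v i))}) := by
  by_cases hlt : ∀ i, pathMean act π N u < pathMean act π N (v i)
  · refine (ExpRare.iUnion fun i => expRare_sum_le_sum hreach hπ (hlt i)).mono fun t ψ _ h => ?_
    simp only [Set.mem_ofPred_eq, hlt, implies_true, iff_true, not_forall, not_lt] at h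
    simpa using h
  by_cases hle : ∀ i, pathMean act π N u ≤ pathMean act π N (v i)
  · obtain ⟨i, hi⟩ := not_forall.1 hlt
    have heq := le_antisymm (hle i) (not_lt.1 hi)
    have h0 := heq ▸ htie i hle heq
    refine ExpRare.empty.mono fun t ψ hψ h => h (iff_of_false (fun h' => ?_) hlt)
    have h1 := h' i
    simp only [apply_transition_eq_zero hreach hπ (hv i) h0 hψ, Finset.sum_const_zero] at h1
    exact h1.not_ge (Finset.sum_nonneg fun _ _ => hu _)
  · obtain ⟨i, hi⟩ := not_forall.1 hle
    refine (expRare_sum_le_sum hreach hπ (not_le.1 hi)).mono fun t ψ _ h => ?_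
    by_contra h2
    exact h (iff_of_false (fun h' => h2 (h' i).le) hlt)

theorem expRare_not_dir_iff_trueDir.{u} (hreach : ∀ x y, Relation.ReflTransGen (Step act) x y)
    {π : X → ℝ} (hπ : IsStationary act π) (R : Sensorium X S) {T₀ : Snapshot S}
    (hT₀ : T₀.IsTrivial) (hties : NoPositiveTies act π R T₀.threshold) (a b : S) :
    ExpRare.{_, _, u} act
      (fun t => {ψ | ¬ ((snapshotAt R T₀ ψ t).Dir a b ↔ TrueDir act π R T₀.threshold a b)}) := by
  by_cases hab : Proper a b
  swap
  · exact ExpRare.empty.mono fun t ψ _ h =>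
      h (iff_of_false (fun h' => hab h'.1) (fun h' => hab h'.1))
  obtain ⟨N, hN⟩ : ∃ N, N = max (R.order a) (R.order b) := ⟨_, rfl⟩
  have ha : R.order a ≤ N := hN ▸ le_max_left _ _
  have hb : R.order b ≤ N := hN ▸ le_max_right _ _
  have ha' : R.order (star a) ≤ N := R.order_star a ▸ ha
  have hb' : R.order (star b) ≤ N := R.order_star b ▸ hb
  let v : Fin 4 → (Fin (N + 1) → X) → ℝ :=
    ![fun _ => T₀.threshold a b, R.coFire N a b, R.coFire N (star a) b,
      R.coFire N (star a) (star b)]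
  have hτ : pathMean act π N (fun _ => T₀.threshold a b) = T₀.threshold a b := by
    have h := hπ.pathMean_one N
    simp only [pathMean_apply, mul_one] at h
    rw [pathMean_apply, ← Finset.sum_mul, h, one_mul]
  have hj1 : pathMean act π N (R.coFire N a b) = jointProb act π R a b := pathMean_coFire hN
  have hj2 : pathMean act π N (R.coFire N (star a) b) = jointProb act π R (star a) b :=
    pathMean_coFire (by rw [R.order_star, hN])
  have hj3 : pathMean act π N (R.coFire N (star a) (star b)) =
      jointProb act π R (star a) (star b) :=
    pathMean_coFire (by rw [R.order_star, R.order_star, hN])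
  have hj4 : pathMean act π N (R.coFire N a (star b)) = jointProb act π R a (star b) :=
    pathMean_coFire (by rw [R.order_star, hN])
  refine (expRare_not_forall_sum_lt_iff hreach hπ (u := R.coFire N a (star b)) (v := v)
    (R.coFire_nonneg N _ _) ?_ ?_).mono fun t ψ _ h => ?_
  · intro i x
    fin_cases i
    exacts [T₀.threshold_nonneg a b hab, R.coFire_nonneg N _ _ _, R.coFire_nonneg N _ _ _,
      R.coFire_nonneg N _ _ _]
  · intro i hle heq
    have h0 := hle 0
    have h1 := hle 1
    have h2 := hle 2
    have h3 := hle 3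
    simp only [v, Matrix.cons_val, hτ, hj1, hj2, hj3, hj4] at h0 h1 h2 h3
    rw [hj4]
    refine hties a b hab (le_antisymm (le_min h0 (le_min h1 (le_min h3 h2))) ?_)
    rw [hj4] at heq
    rw [heq, trueBound]
    fin_cases i <;> simp [v, hτ, hj1, hj2, hj3]
  · have hdir : (snapshotAt R T₀ ψ t).Dir a b ↔
        ∀ i, ∑ k ∈ Finset.range t, R.coFire N a (star b) (transition ψ N ((k + 1 : ℕ) : ℤ)) <
          ∑ k ∈ Finset.range t, v i (transition ψ N ((k + 1 : ℕ) : ℤ)) := by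
      rw [Snapshot.Dir, PocEdge, clock_snapshotAt hT₀ hab, snapshotAt_threshold,
        snapshotAt_weight_eq_sum_coFire hT₀ hab ha hb,
        snapshotAt_weight_eq_sum_coFire hT₀ hab.star_left ha' hb,
        snapshotAt_weight_eq_sum_coFire hT₀ hab.star_left.star_right ha' hb',
        snapshotAt_weight_eq_sum_coFire hT₀ hab.star_right ha hb']
      simp [hab, v, Fin.forall_fin_succ, mul_comm (t : ℝ)]
    have htrue : TrueDir act π R T₀.threshold a b ↔
        ∀ i, pathMean act π N (R.coFire N a (star b)) < pathMean act π N (v i) := by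
      rw [TrueDir, trueBound]
      simp [hab, v, Fin.forall_fin_succ, hτ, hj1, hj2, hj3, hj4]
      tauto
    simpa only [Set.mem_ofPred_eq, hdir, htrue] using h

end Comparison

/-! ### The error -/

section ErrorBound

variable {X A S : Type*} [InvolutiveStar S] [Fintype X] [Fintype A] [Fintype S]
  {act : A → X → X} {π : X → ℝ} {R : Sensorium X S} {T₀ : Snapshot S}

theorem err_nonneg (ψ : ℤ → X) (t : ℕ) : 0 ≤ err act π R T₀ ψ t :=
  Finset.sum_nonneg fun _ _ => Finset.sum_nonneg fun _ _ => abs_nonneg _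

theorem err_le (ψ : ℤ → X) (t : ℕ) : err act π R T₀ ψ t ≤ (Fintype.card S : ℝ) ^ 2 := by
  calc err act π R T₀ ψ t ≤ ∑ _a : S, ∑ _b : S, (1 : ℝ) := by
        refine Finset.sum_le_sum fun a _ => Finset.sum_le_sum fun b _ => ?_
        unfold dirMatrix
        split_ifs <;> simp
    _ = (Fintype.card S : ℝ) ^ 2 := by simp [sq]

theorem err_eq_zero {ψ : ℤ → X} {t : ℕ}
    (h : ∀ a b, (snapshotAt R T₀ ψ t).Dir a b ↔ TrueDir act π R T₀.threshold a b) :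
    err act π R T₀ ψ t = 0 := by
  have h' : (snapshotAt R T₀ ψ t).Dir = TrueDir act π R T₀.threshold :=
    funext₂ fun a b => propext (h a b)
  simp [err, h']

theorem measurable_err [MeasurableSpace X] [DiscreteMeasurableSpace X] (t : ℕ) :
    Measurable (fun ψ : ℤ → X => err act π R T₀ ψ t) := by
  classical
  have hind : ∀ (a : S) (s : ℤ),
      Measurable (fun ψ : ℤ → X => (R.observe ψ s).indicator (1 : S → ℝ) a) := by
    intro a s
    have h : (fun ψ : ℤ → X => (R.observe ψ s).indicator (1 : S → ℝ) a) =
        (fun x => if x ∈ R.realization a then (1 : ℝ) else 0) ∘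
          fun ψ => transition ψ (R.order a) s := by
      ext ψ
      simp [Set.indicator_apply, Sensorium.observe]
    rw [h]
    exact Measurable.of_discrete.comp (measurable_transition _ _)
  have hw : ∀ a b, Measurable (fun ψ : ℤ → X => (snapshotAt R T₀ ψ t).weight a b) := by
    intro a b
    simp only [snapshotAt_weight]
    exact (Finset.measurable_fun_sum _ fun k _ => (hind a _).mul (hind b _)).const_add _
  have hdir : ∀ a b, MeasurableSet {ψ : ℤ → X | (snapshotAt R T₀ ψ t).Dir a b} := by
    intro a b
    simp only [Snapshot.Dir, PocEdge, clock, snapshotAt_threshold]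
    refine (MeasurableSet.const _).inter (measurableSet_lt (hw _ _) ?_)
    exact Measurable.min (Measurable.const_mul (by fun_prop) _) (by fun_prop)
  unfold err dirMatrix
  refine Finset.measurable_fun_sum _ fun a _ => Finset.measurable_fun_sum _ fun b _ => ?_
  exact ((Measurable.ite (hdir a b) measurable_const measurable_const).sub_const _).abs

end ErrorBound

end BinaryAgent

theorem mainTheorem7 {X A S : Type*} [Fintype X] [Fintype A] [Nonempty A] [Fintype S]
    [InvolutiveStar S] [MeasurableSpace X] [DiscreteMeasurableSpace X] [MeasurableSpace A]
    [DiscreteMeasurableSpace A] (act : A → X → X) (hrev : Reversible act)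
    (hconn : (SimpleGraph.fromRel (Step act)).Connected) (R : Sensorium X S) (T₀ : Snapshot S)
    (hT₀ : T₀.IsTrivial) :
    (∃! π : X → ℝ, IsStationary act π) ∧
    ∀ π : X → ℝ, IsStationary act π → NoPositiveTies act π R T₀.threshold →
      ∃ C c : ℝ, 0 < c ∧
        ∀ (Ω : Type*) [MeasurableSpace Ω] (μ : Measure Ω) [IsProbabilityMeasure μ]
          (φ : ℤ → Ω → X) (α : ℤ → Ω → A), IsRandomWalk μ act φ α →
          (∀ t : ℕ, Integrable (fun ω => err act π R T₀ (fun s => φ s ω) t) μ ∧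
            ∫ ω, err act π R T₀ (fun s => φ s ω) t ∂μ ≤ C * Real.exp (-c * t)) ∧
          ∀ᵐ ω ∂μ, Tendsto (fun t : ℕ => err act π R T₀ (fun s => φ s ω) t) atTop (𝓝 0) := by
  have hreach := reflTransGen_step hrev hconn
  have : Nonempty X := hconn.nonempty
  refine ⟨existsUnique_isStationary hreach, fun π hπ hties => ?_⟩
  have hrare : ExpRare act (fun t => {ψ | err act π R T₀ ψ t ≠ 0}) := by
    refine (ExpRare.iUnion fun p : S × S =>
      expRare_not_dir_iff_trueDir hreach hπ R hT₀ hties p.1 p.2).mono fun t ψ _ h => ?_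
    by_contra h'
    simp only [Set.mem_iUnion, not_exists] at h'
    exact h (err_eq_zero fun a b => not_not.1 (h' (a, b)))
  obtain ⟨C, c, hc, H⟩ := hrare
  refine ⟨(Fintype.card S : ℝ) ^ 2 * C, c, hc, fun Ω _ μ _ φ α hw => ?_⟩
  have hφm : Measurable (fun ω (s : ℤ) => φ s ω) := measurable_pi_lambda _ hw.measurable_state
  have herr : ∀ t, Measurable (fun ω => err act π R T₀ (fun s => φ s ω) t) := fun t =>
    (measurable_err t).comp hφm
  have hmem : ∀ t, MeasurableSet {ω | err act π R T₀ (fun s => φ s ω) t ≠ 0} := fun t =>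
    herr t (measurableSet_singleton 0).compl
  refine ⟨fun t => ?_, ?_⟩
  · have hint : Integrable (fun ω => err act π R T₀ (fun s => φ s ω) t) μ :=
      Integrable.of_bound (C := (Fintype.card S : ℝ) ^ 2) (herr t).aestronglyMeasurable
        (ae_of_all _ fun ω => by
          rw [Real.norm_eq_abs, abs_of_nonneg (err_nonneg _ _)]
          exact err_le _ _)
    refine ⟨hint, ?_⟩
    calc ∫ ω, err act π R T₀ (fun s => φ s ω) t ∂μ
        ≤ ∫ ω, {ω | err act π R T₀ (fun s => φ s ω) t ≠ 0}.indicator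
            (fun _ => (Fintype.card S : ℝ) ^ 2) ω ∂μ := by
          refine integral_mono hint ((integrable_const _).indicator (hmem t)) fun ω => ?_
          by_cases h : err act π R T₀ (fun s => φ s ω) t = 0
          · simp [h]
          · simpa [h] using err_le _ _
      _ = (Fintype.card S : ℝ) ^ 2 * μ.real {ω | err act π R T₀ (fun s => φ s ω) t ≠ 0} := by
          rw [integral_indicator_const _ (hmem t), smul_eq_mul, mul_comm]
      _ ≤ (Fintype.card S : ℝ) ^ 2 * C * Real.exp (-c * t) := by
          rw [mul_assoc]
          exact mul_le_mul_of_nonneg_left (H Ω μ φ α hw t) (sq_nonneg _)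
  · -- Borel–Cantelli: almost surely the error is eventually zero.
    have hsum : Summable fun t : ℕ => C * Real.exp (-c * t) := by
      refine Summable.mul_left _ ?_
      simp_rw [mul_comm (-c)]
      exact Real.summable_exp_nat_mul_iff.2 (neg_lt_zero.2 hc)
    have hfin : ∑' t, μ {ω | err act π R T₀ (fun s => φ s ω) t ≠ 0} ≠ ⊤ := by
      refine ne_top_of_le_ne_top hsum.tsum_ofReal_ne_top (ENNReal.tsum_le_tsum fun t => ?_)
      rw [← ofReal_measureReal]
      exact ENNReal.ofReal_le_ofReal (H Ω μ φ α hw t)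
    filter_upwards [ae_eventually_notMem hfin] with ω hω
    refine tendsto_const_nhds.congr' ?_
    filter_upwards [hω] with t ht
    exact (not_not.1 ht).symm
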